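/- Work in ZFC. For a limit ordinal $\lambda$, $j:V_\lambda\prec V_\lambda$ means that $j$ is an elementary embedding of $(V_\lambda,\in)$ into itself other than the identity; its critical sequence is $\kappa_0=\operatorname{crt}(j)$ (the least ordinal $\alpha$ with $j(\alpha)>\alpha$), $\kappa_{n+1}=j(\kappa_n)$, and it is always assumed that $\lambda=\sup_n\kappa_n$. $\mathrm{I3}(\lambda)$ says that such a $j$ exists. For $A\subseteq V_\lambda$ put $j^+(A)=\bigcup_{\alpha<\lambda}j(A\cap V_\alpha)$; for $k:V_\lambda\to V_\lambda$, regarded as its graph, write $j(k)=j^+(k)$. The iterates of $j$ are $j^0=j$, $j^{n+1}=j^n(j^n)$, with models $M_n=V_\lambda$ and maps $j_{n,m}=j^{m-1}\circ\dots\circ j^n:M_n\to M_m$ for $n\le m$. The embedding $j$ is $\omega$-iterable if the direct limit of $(M_n,j_{n,m})_{n\le m<\omega}$ is well-founded; then $M_\omega$ denotes the transitive collapse of this limit and $j_{n,\omega}:V_\lambda\to M_\omega$ the canonical map. **Proposition.** "There exists an $\omega$-iterable $j:V_\lambda\prec V_\lambda$" strongly implies $\mathrm{I3}(\lambda)$.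 That is, for every $\lambda$, if there is an $\omega$-iterable $j:V_\lambda\prec V_\lambda$ then $\mathrm{I3}(\lambda)$ holds, and the least $\lambda$ for which there is an $\omega$-iterable $j:V_\lambda\prec V_\lambda$ (if there is one) is larger than the least $\eta$ such that $\mathrm{I3}(\eta)$ holds. Moreover, for every $\omega$-iterable $j:V_\lambda\prec V_\lambda$ with critical sequence $\langle\kappa_n:n\in\omega\rangle$: 1. $V_\lambda\subseteq M_\omega$; 2. $j_{0,\omega}(\kappa_0)=\lambda$; 3. there is $\gamma<\kappa_0$ such that $\mathrm{I3}(\gamma)$ holds. -/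

import Mathlib

universe u

open scoped ZFSet FirstOrder

namespace RankIntoRank

/-! ### The first-order language of set theory and the structures `(V_lam, ∈)` -/

/-- The only non-logical symbol of the language of set theory: binary membership. -/
inductive MemSymbol : ℕ → Type
  | mem : MemSymbol 2

/-- The first-order language of set theory. -/
def setLang : FirstOrder.Language.{0, 0} := ⟨fun _ => Empty, MemSymbol⟩

/-- The rank-initial segment `V_lam` of the universe, as a type. -/
abbrev V (lam : Ordinal.{u}) : Type (u + 1) := {x : ZFSet.{u} // x ∈ V_ lam}

/-- `V_lam` with the true membership relation. -/
instance instStructureV (lam : Ordinal.{u}) : setLang.Structure (V lam) where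
  funMap f _ := f.elim
  RelMap := fun r xs => match r, xs with
    | .mem, xs => (xs 0).1 ∈ (xs 1).1

/-- The ordinal `α < lam`, as a von Neumann ordinal in `V_lam`. -/
noncomputable def ord {lam : Ordinal.{u}} (α : Set.Iio lam) : V lam :=
  ⟨α.1.toZFSet, ZFSet.mem_vonNeumann.2 (by rw [Ordinal.rank_toZFSet]; exact α.2)⟩

/-! ### Critical points, critical sequences and I3 -/

/-- `κ` is the critical point of `j`: the least ordinal `α` with `α < j α`. -/
def IsCriticalPoint {lam : Ordinal.{u}} (j : V lam → V lam) (κ : Set.Iio lam) : Prop :=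
  IsLeast {α : Set.Iio lam | (ord α).1 ∈ (j (ord α)).1} κ

/-- `κ` is the critical sequence of `j`: `κ 0` is the critical point and `κ (n + 1) = j (κ n)`. -/
structure IsCriticalSequence {lam : Ordinal.{u}} (j : V lam → V lam) (κ : ℕ → Set.Iio lam) :
    Prop where
  zero : IsCriticalPoint j (κ 0)
  succ : ∀ n, ord (κ (n + 1)) = j (ord (κ n))

/-- `j : V_lam ≺ V_lam` is not the identity, `κ` is its critical sequence, and `lam` is the
supremum of `κ`. -/
structure IsI3Embedding {lam : Ordinal.{u}} (j : V lam ↪ₑ[setLang] V lam)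
    (κ : ℕ → Set.Iio lam) : Prop where
  ne_id : (j : V lam → V lam) ≠ id
  crit : IsCriticalSequence j κ
  isLUB : IsLUB (Set.range fun n => (κ n : Ordinal.{u})) lam

/-- The axiom I3 at `lam`. -/
def I3 (lam : Ordinal.{u}) : Prop :=
  ∃ (j : V lam ↪ₑ[setLang] V lam) (κ : ℕ → Set.Iio lam), IsI3Embedding j κ

/-! ### Application and the finite iterates -/

/-- `A ∩ V_α`, an element of `V_lam` when `α < lam`. -/
noncomputable def cut {lam : Ordinal.{u}} (A : Set ZFSet.{u}) (α : Set.Iio lam) : V lam :=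
  ⟨ZFSet.sep (· ∈ A) (V_ α.1),
    ZFSet.mem_vonNeumann_of_subset ZFSet.sep_subset (ZFSet.vonNeumann_mem_of_lt α.2)⟩

/-- The extension `j⁺ A = ⋃_{α < lam} j (A ∩ V_α)` of `j` to subsets `A` of `V_lam`. -/
def plus {lam : Ordinal.{u}} (j : V lam → V lam) (A : Set ZFSet.{u}) : Set ZFSet.{u} :=
  {z | ∃ α : Set.Iio lam, z ∈ (j (cut A α)).1}

/-- The graph of `k : V_lam → V_lam`, a set of Kuratowski pairs. -/
def graph {lam : Ordinal.{u}} (k : V lam → V lam) : Set ZFSet.{u} :=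
  {z | ∃ x : V lam, z = ZFSet.pair x.1 (k x).1}

/-- `l` is the result `j(k) = j⁺(k)` of applying `j` to `k`. -/
def IsApplication {lam : Ordinal.{u}} (j k l : V lam → V lam) : Prop :=
  graph l = plus j (graph k)

/-- `J n` is the `n`-th iterate of `j`: `j^0 = j` and `j^(n+1) = j^n(j^n)`. The models of these
iterates are all equal to `V_lam`, since `j⁺(V_lam) = V_lam` when `lam` is the supremum of the
critical sequence. -/
structure IsIterateSequence {lam : Ordinal.{u}} (j : V lam → V lam) (J : ℕ → V lam → V lam) :
    Prop where
  zero : J 0 = j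
  succ : ∀ n, IsApplication (J n) (J n) (J (n + 1))

/-- `step J m p` is the map `j_{m,m+p} = j^(m+p-1) ∘ ⋯ ∘ j^m`. -/
def step {lam : Ordinal.{u}} (J : ℕ → V lam → V lam) (m : ℕ) : ℕ → V lam → V lam
  | 0 => id
  | p + 1 => J (m + p) ∘ step J m p

theorem step_add {lam : Ordinal.{u}} (J : ℕ → V lam → V lam) (m p q : ℕ) (a : V lam) :
    step J m (p + q) a = step J (m + p) q (step J m p a) := by
  induction q with
  | zero => rfl
  | succ q ih =>
    change J (m + (p + q)) (step J m (p + q) a) = J (m + p + q) _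
    rw [ih, Nat.add_assoc]

/-! ### The `ω`-th iterate -/

/-- The equivalence relation of the direct limit on the pairs `(n, a)` with `a ∈ M_n = V_lam`:
`(n, a)` and `(m, b)` are identified if `j_{n,k} a = j_{m,k} b` for some `k ≥ n, m`. -/
def limitSetoid {lam : Ordinal.{u}} (J : ℕ → V lam → V lam) : Setoid (ℕ × V lam) where
  r x y := ∃ p q, x.1 + p = y.1 + q ∧ step J x.1 p x.2 = step J y.1 q y.2
  iseqv := by
    refine ⟨fun x => ⟨0, 0, rfl, rfl⟩, ?_, ?_⟩
    · rintro x y ⟨p, q, h, e⟩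
      exact ⟨q, p, h.symm, e.symm⟩
    · rintro x y z ⟨p, q, h, e⟩ ⟨r, s, h', e'⟩
      refine ⟨p + r, s + q, by omega, ?_⟩
      rw [step_add, step_add, e, ← e', h, ← h', ← step_add, ← step_add, Nat.add_comm]

/-- The direct limit of the models `M_n = V_lam` along the maps `j_{n,m}`. -/
abbrev Limit {lam : Ordinal.{u}} (J : ℕ → V lam → V lam) : Type (u + 1) :=
  Quotient (limitSetoid J)

/-- The canonical map `j_{n,ω}` into the direct limit. -/
def toLimit {lam : Ordinal.{u}} (J : ℕ → V lam → V lam) (n : ℕ) (a : V lam) : Limit J :=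
  Quotient.mk (limitSetoid J) (n, a)

/-- The membership relation of the direct limit. -/
def limitMem {lam : Ordinal.{u}} (J : ℕ → V lam → V lam) (z w : Limit J) : Prop :=
  ∃ (n : ℕ) (a b : V lam), z = toLimit J n a ∧ w = toLimit J n b ∧ a.1 ∈ b.1

instance instSmallLimit {lam : Ordinal.{u}} (J : ℕ → V lam → V lam) : Small.{u} (Limit J) := by
  have : Small.{u} (V lam) := ZFSet.small_coe (V_ lam)
  exact small_of_surjective (Quotient.mk_surjective (s := limitSetoid J))

/-- The transitive collapse of the direct limit, when its membership relation is well-founded.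
Its range is the transitive `∈`-model `M_ω`. -/
noncomputable def collapse {lam : Ordinal.{u}} {J : ℕ → V lam → V lam}
    (wf : WellFounded (limitMem J)) : Limit J → ZFSet.{u} :=
  wf.fix fun z ih => ZFSet.range fun y : {y : Limit J // limitMem J y z} => ih y.1 y.2

theorem mem_collapse {lam : Ordinal.{u}} {J : ℕ → V lam → V lam}
    (wf : WellFounded (limitMem J)) (z : Limit J) (x : ZFSet.{u}) :
    x ∈ collapse wf z ↔ ∃ y, limitMem J y z ∧ collapse wf y = x := by
  unfold collapse
  rw [wf.fix_eq]
  simp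

/-- The transitive model `M_ω`. -/
def MOmega {lam : Ordinal.{u}} {J : ℕ → V lam → V lam} (wf : WellFounded (limitMem J)) :
    Set ZFSet.{u} :=
  Set.range (collapse wf)

/-- The map `j_{n,ω} : V_lam → M_ω`. -/
noncomputable def iterOmega {lam : Ordinal.{u}} {J : ℕ → V lam → V lam}
    (wf : WellFounded (limitMem J)) (n : ℕ) (a : V lam) : ZFSet.{u} :=
  collapse wf (toLimit J n a)

/-- `j` is `ω`-iterable: its finite iterates exist and their direct limit is well-founded. -/
def OmegaIterable {lam : Ordinal.{u}} (j : V lam → V lam) : Prop :=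
  ∃ J : ℕ → V lam → V lam, IsIterateSequence j J ∧ WellFounded (limitMem J)

/-- There is an `ω`-iterable I3 embedding at `lam`. -/
def OmegaIterableI3 (lam : Ordinal.{u}) : Prop :=
  ∃ (j : V lam ↪ₑ[setLang] V lam) (κ : ℕ → Set.Iio lam), IsI3Embedding j κ ∧ OmegaIterable j

/-- `A` strongly implies `B`: `A` implies `B` at every ordinal, and the least ordinal satisfying
`A`, if there is one, is larger than the least ordinal satisfying `B`. -/
def StronglyImplies (A B : Ordinal.{u} → Prop) : Prop :=
  (∀ lam, A lam → B lam) ∧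
    ∀ lam, IsLeast {x | A x} lam → ∃ eta, IsLeast {x | B x} eta ∧ eta < lam

end RankIntoRank

/-!
Let `J` be the sequence of iterates of `j` and `κ` the critical sequence. Each `J n` is elementary
(`IsApplication.exists_elementary`) with critical sequence `κ n, κ (n + 1), …`, so it fixes the
members of `V_(κ n)` and sends `V_(κ m)` to `V_(κ (m + 1))` for `m ≥ n`
(`IsIterateSequence.isShiftSystem`). Hence `j_{n,ω}` does not move the members of `V_(κ n)`, which
gives `V_lam ⊆ M_ω`; and the members of `j_{0,ω}(κ 0)` are those of the ordinals
`κ n = j_{0,n}(κ 0)`, so that it equals `lam`.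

An I3 embedding below `κ 0` is found as a branch of a tree. The nodes of the tree are partial maps
between levels `V_α → V_α'` that preserve the truth in `V_lam` of finitely many formulas, with
domains that pass the Tarski–Vaught test for these formulas (`Approx`). An infinite branch of the
tree yields an I3 embedding (`exists_I3_of_branch`), and the restrictions of `j` to the levels
`V_(κ m)` are a branch in `V_lam` (`IsShiftSystem.exists_branch`). Suppose there were no branch in
`V_(κ 0)`. Then the part of the tree in `V_(κ 0)` has a rank function in `V_lam`, because `κ 1` is
regular (`IsShiftSystem.exists_rank`). The map `j_{0,n}` sends it to a rank function of the part of
the tree in `V_(κ n)`, and the nodes in `V_(κ n)` are fixed by the later iterates. So the branch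
given by `j` would have ranks that descend through the limit model, which is well-founded
(`IsShiftSystem.exists_low_branch`). This is the absoluteness of well-foundedness between `M_ω` and
the universe, carried out in the limit itself. The branch in `V_(κ 0)` has a supremum of domains
below `κ 0`, because `κ 0` is regular and is not `ω` (`IsShift.exists_bound_nat`).

Because the nodes of index `m` mention only the first `m + 1` formulas, the tree is definable over
`V_lam` one index at a time, and no satisfaction predicate inside set theory is needed.
-/

namespace RankIntoRank

open FirstOrder Language

/-! ### Definable relations on `V_lam` -/

/-- A relation on `V_lam`, in variables indexed by `ι`, that some first-order formula of the
language of set theory defines without parameters. -/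
def Dfn {lam : Ordinal.{u}} {ι : Type} (R : (ι → V lam) → Prop) : Prop :=
  ∃ φ : setLang.Formula ι, ∀ v, φ.Realize v ↔ R v

section Dfn

variable {lam : Ordinal.{u}} {ι : Type}

/-- Elementary embeddings preserve definable relations. -/
theorem Dfn.map_iff {R : (ι → V lam) → Prop} (h : Dfn R) (j : V lam ↪ₑ[setLang] V lam)
    (v : ι → V lam) : R (fun i => j (v i)) ↔ R v := by
  obtain ⟨φ, hφ⟩ := h
  rw [← hφ, ← hφ]
  exact j.map_formula φ v

theorem Dfn.mem (a b : ι) : Dfn (fun v : ι → V lam => (v a).1 ∈ (v b).1) :=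
  ⟨Relations.formula₂ (L := setLang) (show setLang.Relations 2 from MemSymbol.mem)
    (Term.var a) (Term.var b), fun _ => Formula.realize_rel₂.trans Iff.rfl⟩

theorem Dfn.eq (a b : ι) : Dfn (fun v : ι → V lam => v a = v b) :=
  ⟨(Term.var a).equal (Term.var b), fun v => by simp [Formula.realize_equal]⟩

theorem Dfn.realize {n : Type} (φ : setLang.Formula n) (g : n → ι) :
    Dfn (fun v : ι → V lam => φ.Realize (fun i => v (g i))) :=
  ⟨φ.relabel g, fun v => by rw [Formula.realize_relabel]; rfl⟩

variable {R S : (ι → V lam) → Prop}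

theorem Dfn.not (h : Dfn R) : Dfn (fun v => ¬ R v) := by
  obtain ⟨φ, hφ⟩ := h
  exact ⟨φ.not, fun v => by rw [Formula.realize_not, hφ]⟩

theorem Dfn.imp (h : Dfn R) (h' : Dfn S) : Dfn (fun v => R v → S v) := by
  obtain ⟨φ, hφ⟩ := h
  obtain ⟨ψ, hψ⟩ := h'
  exact ⟨φ.imp ψ, fun v => by rw [Formula.realize_imp, hφ, hψ]⟩

theorem Dfn.and (h : Dfn R) (h' : Dfn S) : Dfn (fun v => R v ∧ S v) := by
  obtain ⟨φ, hφ⟩ := h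
  obtain ⟨ψ, hψ⟩ := h'
  exact ⟨φ ⊓ ψ, fun v => by rw [Formula.realize_inf, hφ, hψ]⟩

theorem Dfn.or (h : Dfn R) (h' : Dfn S) : Dfn (fun v => R v ∨ S v) := by
  obtain ⟨φ, hφ⟩ := h
  obtain ⟨ψ, hψ⟩ := h'
  exact ⟨φ ⊔ ψ, fun v => by rw [Formula.realize_sup, hφ, hψ]⟩

theorem Dfn.iff (h : Dfn R) (h' : Dfn S) : Dfn (fun v => R v ↔ S v) := by
  obtain ⟨φ, hφ⟩ := h
  obtain ⟨ψ, hψ⟩ := h'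
  exact ⟨φ.iff ψ, fun v => by rw [Formula.realize_iff, hφ, hψ]⟩

theorem Dfn.const (p : Prop) : Dfn (fun _ : ι → V lam => p) := by
  by_cases hp : p
  · exact ⟨⊤, fun v => by simp [hp, Formula.realize_top]⟩
  · exact ⟨⊥, fun v => by simp [hp, Formula.realize_bot]⟩

theorem Dfn.of_iff (h : Dfn R) (e : ∀ v, R v ↔ S v) : Dfn S := by
  obtain ⟨φ, hφ⟩ := h
  exact ⟨φ, fun v => (hφ v).trans (e v)⟩

theorem Dfn.forall_finite {n : Type} [Finite n] {R : n → (ι → V lam) → Prop} (h : ∀ i, Dfn (R i)) :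
    Dfn (fun v => ∀ i, R i v) := by
  choose φ hφ using h
  exact ⟨Formula.iInf φ, fun v => by simp only [Formula.realize_iInf, hφ]⟩

theorem Dfn.forall_tuple {n : Type} [Finite n] {R : (ι → V lam) → (n → V lam) → Prop}
    (h : Dfn (fun w : ι ⊕ n → V lam => R (fun i => w (.inl i)) (fun i => w (.inr i)))) :
    Dfn (fun v => ∀ x, R v x) := by
  obtain ⟨φ, hφ⟩ := h
  exact ⟨φ.iAlls n, fun v => by simp only [Formula.realize_iAlls, hφ, Sum.elim_inl, Sum.elim_inr]⟩

theorem Dfn.all {R : (ι → V lam) → V lam → Prop}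
    (h : Dfn (fun w : ι ⊕ Unit → V lam => R (fun i => w (.inl i)) (w (.inr ())))) :
    Dfn (fun v => ∀ x, R v x) :=
  (Dfn.forall_tuple (n := Unit) (R := fun v x => R v (x ())) h).of_iff fun _ =>
    ⟨fun H x => H fun _ => x, fun H _ => H _⟩

theorem Dfn.ex {R : (ι → V lam) → V lam → Prop}
    (h : Dfn (fun w : ι ⊕ Unit → V lam => R (fun i => w (.inl i)) (w (.inr ())))) :
    Dfn (fun v => ∃ x, R v x) :=
  (Dfn.all (R := fun v x => ¬ R v x) h.not).not.of_iff fun _ => by simp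

theorem Dfn.realize_update {n : ℕ} (φ : setLang.Formula (Fin n)) (g : Fin n → ι) (i : Fin n)
    (y : ι) :
    Dfn (fun v : ι → V lam => φ.Realize (Function.update (fun l => v (g l)) i (v y))) := by
  refine (Dfn.realize φ (Function.update g i y)).of_iff fun v => iff_of_eq (congrArg _ ?_)
  funext l
  by_cases hl : l = i
  · subst hl
    simp
  · simp [hl]

theorem mem_V_of_mem {x : ZFSet.{u}} {y : V lam} (h : x ∈ y.1) : x ∈ V_ lam :=
  (ZFSet.isTransitive_vonNeumann lam).mem_trans h y.2

theorem V_ext {x y : V lam} (h : ∀ z : V lam, z.1 ∈ x.1 ↔ z.1 ∈ y.1) : x = y :=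
  Subtype.ext <| ZFSet.ext fun z =>
    ⟨fun hz => (h ⟨z, mem_V_of_mem hz⟩).1 hz, fun hz => (h ⟨z, mem_V_of_mem hz⟩).2 hz⟩

theorem V_subset_iff {x y : V lam} : x.1 ⊆ y.1 ↔ ∀ z : V lam, z.1 ∈ x.1 → z.1 ∈ y.1 :=
  ⟨fun h _ hz => h hz, fun h z hz => h ⟨z, mem_V_of_mem hz⟩ hz⟩

theorem Dfn.subset (a b : ι) : Dfn (fun v : ι → V lam => (v a).1 ⊆ (v b).1) :=
  (Dfn.all ((Dfn.mem _ _).imp (Dfn.mem _ _))).of_iff fun _ => V_subset_iff.symm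

theorem Dfn.eq_upair (z x y : ι) : Dfn (fun v : ι → V lam => (v z).1 = {(v x).1, (v y).1}) := by
  refine (Dfn.all (R := fun v w => w.1 ∈ (v z).1 ↔ w = v x ∨ w = v y)
    ((Dfn.mem _ _).iff ((Dfn.eq _ _).or (Dfn.eq _ _)))).of_iff fun v => ⟨fun h => ?_, fun h w => ?_⟩
  · ext w
    rw [ZFSet.mem_pair]
    refine ⟨fun hw => ?_, ?_⟩
    · have := (h ⟨w, mem_V_of_mem hw⟩).1 hw
      simpa only [Subtype.ext_iff] using this
    · rintro (rfl | rfl)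
      · exact (h _).2 (Or.inl rfl)
      · exact (h _).2 (Or.inr rfl)
  · rw [h, ZFSet.mem_pair, Subtype.ext_iff, Subtype.ext_iff]

theorem Dfn.pair_mem (x y s : ι) :
    Dfn (fun v : ι → V lam => ZFSet.pair (v x).1 (v y).1 ∈ (v s).1) := by
  refine (Dfn.ex (R := fun v p => (∃ a b : V lam, a.1 = {(v x).1, (v x).1} ∧
    b.1 = {(v x).1, (v y).1} ∧ p.1 = {a.1, b.1}) ∧ p.1 ∈ (v s).1)
    ((Dfn.ex (Dfn.ex ((Dfn.eq_upair _ _ _).and ((Dfn.eq_upair _ _ _).and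
      (Dfn.eq_upair _ _ _))))).and (Dfn.mem _ _))).of_iff fun v => ⟨?_, fun h => ?_⟩
  · rintro ⟨p, ⟨a, b, ha, hb, hp⟩, hs⟩
    rw [ZFSet.pair_eq_singleton] at ha
    rwa [ZFSet.pair, ← ha, ← hb, ← hp]
  · have hp : ZFSet.pair (v x).1 (v y).1 ∈ V_ lam := mem_V_of_mem h
    have ha : ({(v x).1} : ZFSet) ∈ ZFSet.pair (v x).1 (v y).1 := ZFSet.mem_pair.2 (Or.inl rfl)
    have hb : ({(v x).1, (v y).1} : ZFSet) ∈ ZFSet.pair (v x).1 (v y).1 :=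
      ZFSet.mem_pair.2 (Or.inr rfl)
    exact ⟨⟨_, hp⟩, ⟨⟨_, mem_V_of_mem (y := ⟨_, hp⟩) ha⟩, ⟨_, mem_V_of_mem (y := ⟨_, hp⟩) hb⟩,
      (ZFSet.pair_eq_singleton _).symm, rfl, rfl⟩, h⟩

theorem Dfn.isOrdinal (x : ι) : Dfn (fun v : ι → V lam => (v x).1.IsOrdinal) := by
  refine (Dfn.and (R := fun v => ∀ y : V lam, y.1 ∈ (v x).1 → y.1 ⊆ (v x).1)
    (S := fun v => ∀ y : V lam, y.1 ∈ (v x).1 → ∀ z : V lam, z.1 ∈ y.1 → z.1 ⊆ y.1)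
    (Dfn.all ((Dfn.mem _ _).imp (Dfn.subset _ _)))
    (Dfn.all ((Dfn.mem _ _).imp (Dfn.all ((Dfn.mem _ _).imp (Dfn.subset _ _)))))).of_iff
    fun v => ?_
  rw [ZFSet.isOrdinal_iff_forall_mem_isTransitive]
  refine and_congr ⟨fun h y hy => h ⟨y, mem_V_of_mem hy⟩ hy, fun h y hy => h _ hy⟩
    ⟨fun h y hy z hz => ?_, fun h y hy z hz => h _ hy _ hz⟩
  exact h ⟨y, mem_V_of_mem hy⟩ hy ⟨z, mem_V_of_mem (y := ⟨y, mem_V_of_mem hy⟩) hz⟩ hz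

/-- `h` codes an initial part of the von Neumann hierarchy and `a` is its next level. Each
member of `h` is the union of the power sets of the earlier ones, so no recursion on ordinals
is needed to say this in the language of set theory. -/
def IsHistory (h a : V lam) : Prop :=
  (∀ v : V lam, v.1 ∈ h.1 → ∀ x : V lam, x.1 ∈ v.1 ↔
      ∃ w : V lam, w.1 ∈ h.1 ∧ w.1 ∈ v.1 ∧ x.1 ⊆ w.1) ∧
    ∀ x : V lam, x.1 ∈ a.1 ↔ ∃ w : V lam, w.1 ∈ h.1 ∧ x.1 ⊆ w.1

/-- A set of the form `⋃ w, 𝒫 w`, with the `w` ranging over levels of the hierarchy, is itself a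
level, namely the one of index its rank. -/
theorem eq_vonNeumann_of_levels {a : V lam} (p : V lam → Prop)
    (hp : ∀ w, p w → ∃ β, w.1 = V_ β) (ha : ∀ x : V lam, x.1 ∈ a.1 ↔ ∃ w, p w ∧ x.1 ⊆ w.1) :
    ∃ α, a.1 = V_ α := by
  refine ⟨a.1.rank, ZFSet.ext fun x => ?_⟩
  rw [ZFSet.mem_vonNeumann]
  refine ⟨ZFSet.rank_lt_of_mem, fun hx => ?_⟩
  obtain ⟨y, hy, hxy⟩ := ZFSet.lt_rank_iff.1 hx
  obtain ⟨w, hw, hyw⟩ := (ha ⟨y, mem_V_of_mem hy⟩).1 hy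
  obtain ⟨β, hβ⟩ := hp w hw
  refine (ha ⟨x, ?_⟩).2 ⟨w, hw, ?_⟩
  · exact ZFSet.mem_vonNeumann.2 (hx.trans (ZFSet.mem_vonNeumann.1 a.2))
  · rw [hβ, ZFSet.subset_vonNeumann] at hyw ⊢
    exact hxy.trans hyw

theorem exists_isHistory_iff {a : V lam} : (∃ h, IsHistory h a) ↔ ∃ α, a.1 = V_ α := by
  constructor
  · rintro ⟨h, hh, ha⟩
    refine eq_vonNeumann_of_levels (fun w => w.1 ∈ h.1) (fun w hw => ?_) ha
    obtain ⟨w, hwV⟩ := w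
    induction w using ZFSet.inductionOn with
    | _ w ih =>
      exact eq_vonNeumann_of_levels (fun u => u.1 ∈ h.1 ∧ u.1 ∈ w)
        (fun u hu => ih u.1 hu.2 u.2 hu.1) (fun x => by simpa only [and_assoc] using hh _ hw x)
  · rintro ⟨α, hα⟩
    have hlt : α < lam := by
      have := ZFSet.mem_vonNeumann.1 a.2
      rwa [hα, ZFSet.rank_vonNeumann] at this
    let h : ZFSet.{u} := ZFSet.range fun β : Set.Iio α => V_ β.1
    have hmem : ∀ {w}, w ∈ h ↔ ∃ β < α, V_ β = w := by simp [h]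
    have hV : h ∈ V_ lam := by
      rw [ZFSet.mem_vonNeumann]
      refine lt_of_le_of_lt (ZFSet.rank_le_iff.2 fun w hw => ?_) hlt
      obtain ⟨β, hβ, rfl⟩ := hmem.1 hw
      rwa [ZFSet.rank_vonNeumann]
    refine ⟨⟨h, hV⟩, ?_, ?_⟩
    · intro v hv x
      obtain ⟨β, hβ, hvβ⟩ := hmem.1 hv
      rw [← hvβ, ZFSet.mem_vonNeumann']
      constructor
      · rintro ⟨γ, hγ, hx⟩
        exact ⟨⟨V_ γ, ZFSet.vonNeumann_mem_of_lt ((hγ.trans hβ).trans hlt)⟩,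
          hmem.2 ⟨γ, hγ.trans hβ, rfl⟩, ZFSet.vonNeumann_mem_of_lt hγ, hx⟩
      · rintro ⟨w, hw, hwv, hx⟩
        obtain ⟨γ, hγ, hwγ⟩ := hmem.1 hw
        rw [← hwγ] at hwv hx
        exact ⟨γ, ZFSet.vonNeumann_mem_vonNeumann_iff.1 hwv, hx⟩
    · intro x
      rw [hα, ZFSet.mem_vonNeumann']
      constructor
      · rintro ⟨γ, hγ, hx⟩
        exact ⟨⟨V_ γ, ZFSet.vonNeumann_mem_of_lt (hγ.trans hlt)⟩, hmem.2 ⟨γ, hγ, rfl⟩, hx⟩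
      · rintro ⟨w, hw, hx⟩
        obtain ⟨γ, hγ, hwγ⟩ := hmem.1 hw
        exact ⟨γ, hγ, hwγ ▸ hx⟩

theorem Dfn.eq_vonNeumann (a : ι) : Dfn (fun v : ι → V lam => ∃ α, (v a).1 = V_ α) := by
  refine (Dfn.ex (R := fun v h => IsHistory h (v a)) (Dfn.and ?_ ?_)).of_iff
    fun v => exists_isHistory_iff
  · exact Dfn.all ((Dfn.mem _ _).imp (Dfn.all ((Dfn.mem _ _).iff (Dfn.ex
      ((Dfn.mem _ _).and ((Dfn.mem _ _).and (Dfn.subset _ _)))))))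
  · exact Dfn.all ((Dfn.mem _ _).iff (Dfn.ex ((Dfn.mem _ _).and (Dfn.subset _ _))))

/-- `V_(rank x)` is the only level that includes `x` without having `x` as a member. -/
theorem Dfn.eq_vonNeumann_rank (a x : ι) :
    Dfn (fun v : ι → V lam => (v a).1 = V_ (v x).1.rank) := by
  refine ((Dfn.eq_vonNeumann a).and ((Dfn.subset x a).and (Dfn.mem x a).not)).of_iff fun v =>
    ⟨?_, fun h => ⟨⟨_, h⟩, ?_, ?_⟩⟩
  · rintro ⟨⟨α, hα⟩, h1, h2⟩
    rw [hα, ZFSet.subset_vonNeumann] at h1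
    rw [hα, ZFSet.mem_vonNeumann, not_lt] at h2
    rw [hα, le_antisymm h1 h2]
  · rw [h, ZFSet.subset_vonNeumann]
  · rw [h, ZFSet.mem_vonNeumann]
    exact lt_irrefl _

end Dfn

/-! ### Elementary embeddings and the von Neumann hierarchy -/

section Embedding

variable {lam : Ordinal.{u}}

/-- The level `V_α`, for `α < lam`, as an element of `V_lam`. -/
noncomputable def lev (α : Set.Iio lam) : V lam :=
  ⟨V_ α.1, ZFSet.vonNeumann_mem_of_lt α.2⟩

theorem ord_mem_ord_iff {α β : Set.Iio lam} : (ord α).1 ∈ (ord β).1 ↔ α < β :=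
  Ordinal.toZFSet_mem_toZFSet_iff

theorem map_mem_iff (j : V lam ↪ₑ[setLang] V lam) (x y : V lam) :
    (j x).1 ∈ (j y).1 ↔ x.1 ∈ y.1 :=
  (Dfn.mem (0 : Fin 2) 1).map_iff j ![x, y]

theorem map_subset_iff (j : V lam ↪ₑ[setLang] V lam) (x y : V lam) :
    (j x).1 ⊆ (j y).1 ↔ x.1 ⊆ y.1 :=
  (Dfn.subset (0 : Fin 2) 1).map_iff j ![x, y]

theorem map_pair_mem_iff (j : V lam ↪ₑ[setLang] V lam) (x y s : V lam) :
    ZFSet.pair (j x).1 (j y).1 ∈ (j s).1 ↔ ZFSet.pair x.1 y.1 ∈ s.1 :=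
  (Dfn.pair_mem (0 : Fin 3) 1 2).map_iff j ![x, y, s]

theorem map_isOrdinal_iff (j : V lam ↪ₑ[setLang] V lam) (x : V lam) :
    (j x).1.IsOrdinal ↔ x.1.IsOrdinal :=
  (Dfn.isOrdinal (0 : Fin 1)).map_iff j ![x]

theorem map_lev_eq (j : V lam ↪ₑ[setLang] V lam) (α : Set.Iio lam) :
    (j (lev α)).1 = V_ (j (ord α)).1.rank := by
  refine ((Dfn.eq_vonNeumann_rank (0 : Fin 2) 1).map_iff j ![lev α, ord α]).2 ?_
  change V_ α.1 = V_ (α.1.toZFSet.rank)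
  rw [Ordinal.rank_toZFSet]

theorem map_lev_iff (j : V lam ↪ₑ[setLang] V lam) {α β : Set.Iio lam} :
    j (lev α) = lev β ↔ j (ord α) = ord β := by
  rw [Subtype.ext_iff, map_lev_eq, lev, ZFSet.vonNeumann_inj]
  constructor
  · intro h
    have ho : (j (ord α)).1.IsOrdinal :=
      (map_isOrdinal_iff j _).2 (ZFSet.isOrdinal_toZFSet α.1)
    refine Subtype.ext ?_
    rw [← ho.toZFSet_rank_eq, h]
    rfl
  · intro h
    rw [h]
    exact Ordinal.rank_toZFSet _

theorem IsCriticalPoint.map_ord {j : V lam ↪ₑ[setLang] V lam} {κ : Set.Iio lam}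
    (h : IsCriticalPoint j κ) {α : Set.Iio lam} (hα : α < κ) : j (ord α) = ord α := by
  induction α using WellFoundedLT.induction with
  | _ α ih =>
    have ho : (j (ord α)).1.IsOrdinal :=
      (map_isOrdinal_iff j _).2 (ZFSet.isOrdinal_toZFSet α.1)
    refine Subtype.ext (subset_antisymm ?_ fun x hx => ?_)
    · exact (ZFSet.IsOrdinal.notMem_iff_subset (ZFSet.isOrdinal_toZFSet _) ho).1
        fun hm => hα.not_ge (h.2 hm)
    · obtain ⟨β, hβ, rfl⟩ := Ordinal.mem_toZFSet_iff.1 hx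
      let b : Set.Iio lam := ⟨β, hβ.trans α.2⟩
      have hb : b < α := hβ
      have := (map_mem_iff j (ord b) (ord α)).2 (ord_mem_ord_iff.2 hb)
      rwa [ih b hb (hb.trans hα)] at this

/-- An elementary embedding is the identity below its critical point, not only on ordinals:
by induction on rank, since it fixes the level `V_(rank x)` and so cannot add members to `x`. -/
theorem IsCriticalPoint.map_eq_self {j : V lam ↪ₑ[setLang] V lam} {κ : Set.Iio lam}
    (h : IsCriticalPoint j κ) (x : V lam) (hx : x.1 ∈ V_ κ.1) : j x = x := by
  induction hr : x.1.rank using WellFoundedLT.induction generalizing x with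
  | _ α ih =>
    subst hr
    have hlt : x.1.rank < κ.1 := ZFSet.mem_vonNeumann.1 hx
    let α : Set.Iio lam := ⟨x.1.rank, hlt.trans κ.2⟩
    have hfix : ∀ z : V lam, z.1.rank < x.1.rank → j z = z := fun z hz =>
      ih _ hz z (ZFSet.mem_vonNeumann.2 (hz.trans hlt)) rfl
    have hlev : j (lev α) = lev α := (map_lev_iff j).2 (h.map_ord hlt)
    have hsub : (j x).1 ⊆ (lev α).1 := by
      rw [← hlev, map_subset_iff]
      exact ZFSet.subset_vonNeumann_self _
    refine V_ext fun z => ⟨fun hz => ?_, fun hz => ?_⟩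
    · rw [← map_mem_iff j, hfix z (ZFSet.mem_vonNeumann.1 (hsub hz))]
      exact hz
    · have := (map_mem_iff j _ _).2 hz
      rwa [hfix z (ZFSet.rank_lt_of_mem hz)] at this

/-- What is used of a critical sequence `c` of `k`, with the levels `V_(c i)` in place of the
ordinals `c i`. -/
structure IsShift (k : V lam → V lam) (c : ℕ → Set.Iio lam) : Prop where
  strictMono : StrictMono c
  fix : ∀ x : V lam, x.1 ∈ V_ (c 0).1 → k x = x
  map_lev : ∀ i, k (lev (c i)) = lev (c (i + 1))

theorem IsI3Embedding.isShift {j : V lam ↪ₑ[setLang] V lam} {κ : ℕ → Set.Iio lam}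
    (h : IsI3Embedding j κ) : IsShift j κ where
  strictMono := by
    refine strictMono_nat_of_lt_succ fun n => ?_
    induction n with
    | zero =>
      rw [← ord_mem_ord_iff, h.crit.succ]
      exact h.crit.zero.1
    | succ n ih =>
      have := (map_mem_iff j _ _).2 (ord_mem_ord_iff.2 ih)
      rwa [← h.crit.succ, ← h.crit.succ, ord_mem_ord_iff] at this
  fix := h.crit.zero.map_eq_self
  map_lev i := (map_lev_iff j).2 (h.crit.succ i).symm

theorem IsI3Embedding.exists_mem {j : V lam ↪ₑ[setLang] V lam} {κ : ℕ → Set.Iio lam}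
    (h : IsI3Embedding j κ) (x : V lam) : ∃ n, x.1 ∈ V_ (κ n).1 := by
  obtain ⟨_, ⟨n, rfl⟩, hn⟩ := (lt_isLUB_iff h.isLUB).1 (ZFSet.mem_vonNeumann.1 x.2)
  exact ⟨n, ZFSet.mem_vonNeumann.2 hn⟩

theorem pair_mem_vonNeumann {β : Ordinal.{u}} {x y : ZFSet.{u}} (hx : x ∈ V_ β) (hy : y ∈ V_ β) :
    ZFSet.pair x y ∈ V_ (β + 1 + 1) := by
  have h : ∀ {z}, z ∈ V_ β → ({x, z} : ZFSet.{u}) ∈ V_ (β + 1) := fun hz => by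
    rw [ZFSet.vonNeumann_add_one, ZFSet.mem_powerset]
    intro w hw
    obtain rfl | rfl := ZFSet.mem_pair.1 hw
    exacts [hx, hz]
  rw [ZFSet.vonNeumann_add_one, ZFSet.mem_powerset, ZFSet.pair]
  intro w hw
  obtain rfl | rfl := ZFSet.mem_pair.1 hw
  · rw [← ZFSet.pair_eq_singleton]
    exact h hx
  · exact h hy

theorem IsShift.pair_mem {k : V lam → V lam} {c : ℕ → Set.Iio lam} (hc : IsShift k c) {n : ℕ}
    {x y : ZFSet.{u}} (hx : x ∈ V_ (c n).1) (hy : y ∈ V_ (c n).1) :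
    ZFSet.pair x y ∈ V_ (c (n + 2)).1 := by
  refine ZFSet.vonNeumann_subset_of_le ?_ (pair_mem_vonNeumann hx hy)
  have h1 : (c n).1 < (c (n + 1)).1 := hc.strictMono n.lt_succ_self
  have h2 : (c (n + 1)).1 < (c (n + 2)).1 := hc.strictMono (n + 1).lt_succ_self
  exact Order.add_one_le_of_lt ((Order.add_one_le_of_lt h1).trans_lt h2)

/-! ### The iterates of an embedding -/

theorem pair_mem_cut_graph {k : V lam → V lam} {α : Set.Iio lam} {x y : V lam} :
    ZFSet.pair x.1 y.1 ∈ (cut (graph k) α).1 ↔ ZFSet.pair x.1 y.1 ∈ V_ α.1 ∧ k x = y := by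
  rw [cut, ZFSet.mem_sep, graph]
  refine and_congr_right fun _ => ⟨?_, ?_⟩
  · rintro ⟨z, hz⟩
    rw [ZFSet.pair_inj] at hz
    obtain rfl : x = z := Subtype.ext hz.1
    exact Subtype.ext hz.2.symm
  · rintro rfl
    exact ⟨x, rfl⟩

theorem IsApplication.exists_mem {k l : V lam → V lam} (h : IsApplication k k l) (x : V lam) :
    ∃ α, ZFSet.pair x.1 (l x).1 ∈ (k (cut (graph k) α)).1 := by
  have : ZFSet.pair x.1 (l x).1 ∈ graph l := ⟨x, rfl⟩
  rwa [h] at this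

theorem IsApplication.eq_of_mem {k l : V lam → V lam} (h : IsApplication k k l) {x y : V lam}
    {α : Set.Iio lam} (hxy : ZFSet.pair x.1 y.1 ∈ (k (cut (graph k) α)).1) : l x = y := by
  have : ZFSet.pair x.1 y.1 ∈ graph l := by
    rw [h]
    exact ⟨α, hxy⟩
  obtain ⟨z, hz⟩ := this
  rw [ZFSet.pair_inj] at hz
  obtain rfl : x = z := Subtype.ext hz.1
  exact Subtype.ext hz.2.symm

/-- `k(k)` is elementary: that the bounded pieces of the graph of `k` preserve the truth of a
given formula is itself a first-order statement, which `k` transfers to the pieces of `k(k)`. -/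
theorem IsApplication.exists_elementary {k : V lam ↪ₑ[setLang] V lam} {l : V lam → V lam}
    (h : IsApplication k k l) : ∃ e : V lam ↪ₑ[setLang] V lam, ⇑e = l := by
  refine ⟨⟨l, fun n φ x => ?_⟩, rfl⟩
  choose α hα using fun i => h.exists_mem (x i)
  let R : (Fin n → V lam) → Prop := fun g => ∀ x y : Fin n → V lam,
    (∀ i, ZFSet.pair (x i).1 (y i).1 ∈ (g i).1) → (φ.Realize y ↔ φ.Realize x)
  have hR : Dfn R := Dfn.forall_tuple (Dfn.forall_tuple
    ((Dfn.forall_finite fun i => Dfn.pair_mem _ _ _).imp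
      ((Dfn.realize φ Sum.inr).iff (Dfn.realize φ fun i => Sum.inl (Sum.inr i)))))
  refine (hR.map_iff k fun i => cut (graph k) (α i)).2 (fun x y hxy => ?_) x (l ∘ x) hα
  obtain rfl : (fun i => k (x i)) = y := funext fun i => (pair_mem_cut_graph.1 (hxy i)).2
  exact k.map_formula φ x

theorem IsShift.isApplication {k : V lam ↪ₑ[setLang] V lam} {c : ℕ → Set.Iio lam}
    (hc : IsShift k c) {l : V lam → V lam} (h : IsApplication k k l) :
    IsShift l (fun i => c (i + 1)) where
  strictMono := hc.strictMono.comp fun _ _ => Nat.succ_lt_succ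
  fix x hx := by
    refine h.eq_of_mem (α := c 2) ?_
    let R : (Fin 2 → V lam) → Prop := fun v =>
      ∀ x : V lam, x.1 ∈ (v 0).1 → ZFSet.pair x.1 x.1 ∈ (v 1).1
    have hR : Dfn R := Dfn.all ((Dfn.mem _ _).imp (Dfn.pair_mem _ _ _))
    have := (hR.map_iff k ![lev (c 0), cut (graph k) (c 2)]).2 fun x hx =>
      pair_mem_cut_graph.2 ⟨hc.pair_mem hx hx, hc.fix x hx⟩
    refine this x ?_
    change x.1 ∈ (k (lev (c 0))).1
    rw [hc.map_lev]
    exact hx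
  map_lev i := by
    have hlt : ∀ {m n}, m < n → (lev (c m)).1 ∈ V_ (c n).1 := fun hmn =>
      ZFSet.vonNeumann_mem_of_lt (hc.strictMono hmn)
    refine h.eq_of_mem (α := c (i + 2 + 2)) ?_
    rw [← hc.map_lev i, ← hc.map_lev (i + 1), map_pair_mem_iff, pair_mem_cut_graph]
    exact ⟨hc.pair_mem (hlt (by omega)) (hlt (by omega)), hc.map_lev i⟩

/-- The data that the argument needs of the iterates `J n`: they are elementary, `J n` has
critical sequence `κ n, κ (n + 1), …`, and `κ` is cofinal in `lam`. -/
structure IsShiftSystem (J : ℕ → V lam → V lam) (κ : ℕ → Set.Iio lam) : Prop where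
  elementary : ∀ n, ∃ e : V lam ↪ₑ[setLang] V lam, ⇑e = J n
  isShift : ∀ n, IsShift (J n) (fun i => κ (n + i))
  exists_mem : ∀ x : V lam, ∃ n, x.1 ∈ V_ (κ n).1

theorem IsIterateSequence.isShiftSystem {j : V lam ↪ₑ[setLang] V lam} {κ : ℕ → Set.Iio lam}
    {J : ℕ → V lam → V lam} (hJ : IsIterateSequence j J) (hj : IsI3Embedding j κ) :
    IsShiftSystem J κ := by
  have key : ∀ n, (∃ e : V lam ↪ₑ[setLang] V lam, ⇑e = J n) ∧
      IsShift (J n) (fun i => κ (n + i)) := by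
    intro n
    induction n with
    | zero =>
      refine ⟨⟨j, hJ.zero.symm⟩, ?_⟩
      simpa only [hJ.zero, Nat.zero_add] using hj.isShift
    | succ n ih =>
      obtain ⟨⟨e, he⟩, hs⟩ := ih
      have happ := hJ.succ n
      rw [← he] at happ hs
      refine ⟨happ.exists_elementary, ?_⟩
      have := hs.isApplication happ
      simpa only [Nat.succ_add_eq_add_succ] using this
  exact ⟨fun n => (key n).1, fun n => (key n).2, hj.exists_mem⟩

namespace IsShiftSystem

variable {J : ℕ → V lam → V lam} {κ : ℕ → Set.Iio lam}

theorem strictMono (h : IsShiftSystem J κ) : StrictMono κ := by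
  simpa only [Nat.zero_add] using (h.isShift 0).strictMono

theorem mem_of_le (h : IsShiftSystem J κ) {m n : ℕ} (hmn : m ≤ n) {x : ZFSet.{u}}
    (hx : x ∈ V_ (κ m).1) :
    x ∈ V_ (κ n).1 :=
  ZFSet.vonNeumann_subset_of_le (h.strictMono.monotone hmn) hx

theorem exists_step (h : IsShiftSystem J κ) (m p : ℕ) :
    ∃ e : V lam ↪ₑ[setLang] V lam, ⇑e = step J m p := by
  induction p with
  | zero => exact ⟨ElementaryEmbedding.refl _ _, rfl⟩
  | succ p ih =>
    obtain ⟨e, he⟩ := ih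
    obtain ⟨f, hf⟩ := h.elementary (m + p)
    refine ⟨f.comp e, ?_⟩
    rw [step, ← he, ← hf]
    rfl

theorem step_fix (h : IsShiftSystem J κ) {m : ℕ} (p : ℕ) {x : V lam} (hx : x.1 ∈ V_ (κ m).1) :
    step J m p x = x := by
  induction p with
  | zero => rfl
  | succ p ih =>
    change J (m + p) (step J m p x) = x
    rw [ih]
    exact (h.isShift (m + p)).fix x (h.mem_of_le (by omega) hx)

theorem step_lev (h : IsShiftSystem J κ) (m p : ℕ) : step J m p (lev (κ m)) = lev (κ (m + p)) := by
  induction p with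
  | zero => rfl
  | succ p ih =>
    change J (m + p) (step J m p _) = _
    rw [ih]
    exact (h.isShift (m + p)).map_lev 0

theorem step_ord (h : IsShiftSystem J κ) (m p : ℕ) : step J m p (ord (κ m)) = ord (κ (m + p)) := by
  obtain ⟨e, he⟩ := h.exists_step m p
  have := h.step_lev m p
  rwa [← he, map_lev_iff, he] at this

/-- `V_(κ m)` is an elementary submodel of `V_lam`, in the form of the Tarski–Vaught criterion:
a witness below `κ (m + p)` is pulled back along `j_{m,m+p}`, which sends `V_(κ m)` to
`V_(κ (m + p))` and fixes the members of `V_(κ m)`. -/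
theorem exists_witness (h : IsShiftSystem J κ) {n : ℕ} (φ : setLang.Formula (Fin n))
    {m : ℕ} {x : Fin n → V lam} {i : Fin n} (hx : ∀ l, l ≠ i → (x l).1 ∈ V_ (κ m).1)
    (hφ : φ.Realize x) :
    ∃ y : V lam, y.1 ∈ V_ (κ m).1 ∧ φ.Realize (Function.update x i y) := by
  obtain ⟨q, hq⟩ := h.exists_mem (x i)
  obtain ⟨e, he⟩ := h.exists_step m q
  let R : (Fin n ⊕ Unit → V lam) → Prop := fun v => ∃ y : V lam, y.1 ∈ (v (.inr ())).1 ∧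
    φ.Realize (Function.update (fun l => v (.inl l)) i y)
  have hR : Dfn R := Dfn.ex ((Dfn.mem _ _).and
    (Dfn.realize_update φ (fun l => Sum.inl (Sum.inl l)) i _))
  have hv := hR.map_iff e (Sum.elim x fun _ => lev (κ m))
  have hupd : ∀ y, Function.update (fun l => e (x l)) i y = Function.update x i y := fun y => by
    funext l
    by_cases hl : l = i
    · subst hl
      simp
    · simp only [Function.update_of_ne hl]
      rw [he, h.step_fix q (hx l hl)]
  refine hv.1 ⟨x i, ?_, ?_⟩
  · change _ ∈ (e (lev (κ m))).1
    rw [he, h.step_lev]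
    exact h.mem_of_le (Nat.le_add_left _ _) hq
  · change φ.Realize (Function.update (fun l => e (x l)) i (x i))
    rwa [hupd, Function.update_eq_self]

end IsShiftSystem
end Embedding

/-! ### The limit model contains `V_lam` -/

section Collapse

variable {lam : Ordinal.{u}} {J : ℕ → V lam → V lam} {κ : ℕ → Set.Iio lam}

theorem toLimit_step (n p : ℕ) (a : V lam) :
    toLimit J (n + p) (step J n p a) = toLimit J n a :=
  Quotient.sound ⟨0, p, rfl, rfl⟩

theorem IsShiftSystem.exists_of_limitMem (h : IsShiftSystem J κ) {y : Limit J} {n : ℕ} {b : V lam}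
    (hy : limitMem J y (toLimit J n b)) :
    ∃ p a, y = toLimit J (n + p) a ∧ a.1 ∈ (step J n p b).1 := by
  obtain ⟨m, a, c, rfl, hbc, hac⟩ := hy
  obtain ⟨p, q, hpq, hs⟩ := Quotient.exact hbc
  change n + p = m + q at hpq
  change step J n p b = step J m q c at hs
  refine ⟨p, step J m q a, ?_, ?_⟩
  · rw [hpq, toLimit_step]
  · obtain ⟨e, he⟩ := h.exists_step m q
    rw [hs, ← he, map_mem_iff]
    exact hac

/-- The members of `V_(κ n)` are not moved by `j_{n,ω}`, because every later iterate fixes them. -/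
theorem IsShiftSystem.collapse_toLimit (h : IsShiftSystem J κ) (wf : WellFounded (limitMem J))
    (a : V lam) (n : ℕ) (ha : a.1 ∈ V_ (κ n).1) : collapse wf (toLimit J n a) = a.1 := by
  obtain ⟨a, haV⟩ := a
  induction a using ZFSet.inductionOn generalizing n with
  | _ a ih =>
    have htr : ∀ {x}, x ∈ a → x ∈ V_ (κ n).1 := fun hx =>
      (ZFSet.isTransitive_vonNeumann _).mem_trans hx ha
    ext x
    rw [mem_collapse]
    constructor
    · rintro ⟨y, hy, rfl⟩
      obtain ⟨p, b, rfl, hb⟩ := h.exists_of_limitMem hy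
      rw [h.step_fix p ha] at hb
      rw [ih b.1 hb _ b.2 (h.mem_of_le (Nat.le_add_right n p) (htr hb))]
      exact hb
    · intro hx
      have hxV : x ∈ V_ lam := mem_V_of_mem (y := ⟨a, haV⟩) hx
      exact ⟨toLimit J n ⟨x, hxV⟩, ⟨n, _, _, rfl, rfl, hx⟩, ih x hx n hxV (htr hx)⟩

theorem IsShiftSystem.mem_MOmega (h : IsShiftSystem J κ) (wf : WellFounded (limitMem J))
    {x : ZFSet.{u}} (hx : x ∈ V_ lam) : x ∈ MOmega wf := by
  obtain ⟨n, hn⟩ := h.exists_mem ⟨x, hx⟩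
  exact ⟨_, h.collapse_toLimit wf ⟨x, hx⟩ n hn⟩

theorem IsShiftSystem.iterOmega_ord (h : IsShiftSystem J κ) (wf : WellFounded (limitMem J)) :
    iterOmega wf 0 (ord (κ 0)) = lam.toZFSet := by
  ext x
  rw [iterOmega, mem_collapse, Ordinal.mem_toZFSet_iff]
  constructor
  · rintro ⟨y, hy, rfl⟩
    obtain ⟨p, b, rfl, hb⟩ := h.exists_of_limitMem hy
    rw [h.step_ord] at hb
    rw [h.collapse_toLimit wf b _ (Ordinal.toZFSet_subset_vonNeumann _ hb)]
    obtain ⟨β, hβ, hb⟩ := Ordinal.mem_toZFSet_iff.1 hb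
    exact ⟨β, hβ.trans (κ (0 + p)).2, hb⟩
  · rintro ⟨β, hβ, rfl⟩
    obtain ⟨n, hn⟩ := h.exists_mem (ord ⟨β, hβ⟩)
    refine ⟨toLimit J n (ord ⟨β, hβ⟩), ?_, h.collapse_toLimit wf _ n hn⟩
    refine ⟨n, _, ord (κ n), rfl, ?_, ord_mem_ord_iff.2 ?_⟩
    · have := toLimit_step (J := J) 0 n (ord (κ 0))
      rwa [h.step_ord, Nat.zero_add, eq_comm] at this
    · rw [ZFSet.mem_vonNeumann, ord, Ordinal.rank_toZFSet] at hn
      exact hn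

end Collapse

/-! ### Regularity of the critical point -/

section Regular

variable {lam : Ordinal.{u}}

/-- The graph of `G` restricted to `x`, cut down to the set `b` in order to be a member of
`V_lam`; it is the full graph when `b` contains all the pairs. -/
noncomputable def graphOn (b x : V lam) (G : V lam → ZFSet.{u}) : V lam :=
  ⟨ZFSet.sep (fun z => ∃ y : V lam, y.1 ∈ x.1 ∧ z = ZFSet.pair y.1 (G y)) b.1,
    ZFSet.mem_vonNeumann_of_subset ZFSet.sep_subset b.2⟩

theorem mem_graphOn {b x : V lam} {G : V lam → ZFSet.{u}} {z : ZFSet.{u}} :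
    z ∈ (graphOn b x G).1 ↔ z ∈ b.1 ∧ ∃ y : V lam, y.1 ∈ x.1 ∧ z = ZFSet.pair y.1 (G y) := by
  rw [graphOn, ZFSet.mem_sep]

theorem pair_mem_graphOn {b x : V lam} {G : V lam → ZFSet.{u}}
    (hb : ∀ y : V lam, y.1 ∈ x.1 → ZFSet.pair y.1 (G y) ∈ b.1) {y : V lam} {w : ZFSet.{u}} :
    ZFSet.pair y.1 w ∈ (graphOn b x G).1 ↔ y.1 ∈ x.1 ∧ w = G y := by
  rw [mem_graphOn]
  constructor
  · rintro ⟨-, z, hz, h⟩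
    rw [ZFSet.pair_inj] at h
    obtain rfl : y = z := Subtype.ext h.1
    exact ⟨hz, h.2⟩
  · rintro ⟨hy, rfl⟩
    exact ⟨hb y hy, y, hy, rfl⟩

/-- The critical point is regular with respect to domains of smaller rank: a cofinal map `F` would
be sent to a map that is cofinal in the image of the critical point but has the same values. -/
theorem IsShift.exists_bound {k : V lam ↪ₑ[setLang] V lam} {c : ℕ → Set.Iio lam}
    (hc : IsShift k c) {x : V lam} (hx : x.1 ∈ V_ (c 0).1) (F : V lam → Ordinal.{u})
    (hF : ∀ y : V lam, y.1 ∈ x.1 → F y < (c 0).1) :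
    ∃ β < (c 0).1, ∀ y : V lam, y.1 ∈ x.1 → F y < β := by
  by_contra! hcon
  have htr : ∀ {y}, y ∈ x.1 → y ∈ V_ (c 0).1 := fun hy =>
    (ZFSet.isTransitive_vonNeumann _).mem_trans hy hx
  let f : V lam := graphOn (lev (c 2)) x fun y => V_ (F y)
  have hf : ∀ {y : V lam} {w}, ZFSet.pair y.1 w ∈ f.1 ↔ y.1 ∈ x.1 ∧ w = V_ (F y) :=
    pair_mem_graphOn fun y hy =>
      hc.pair_mem (htr hy) (ZFSet.vonNeumann_mem_of_lt (hF y hy))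
  let R : (Fin 3 → V lam) → Prop := fun v => ∀ z : V lam, z.1 ∈ (v 0).1 →
    ∃ y : V lam, y.1 ∈ (v 1).1 ∧ ∃ w : V lam, ZFSet.pair y.1 w.1 ∈ (v 2).1 ∧ z.1 ⊆ w.1
  have hR : Dfn R := Dfn.all ((Dfn.mem _ _).imp (Dfn.ex ((Dfn.mem _ _).and
    (Dfn.ex ((Dfn.pair_mem _ _ _).and (Dfn.subset _ _))))))
  -- The image of `f` is still a function, so its values are those of `f`, fixed by `k`.
  let S : (Fin 1 → V lam) → Prop := fun v => ∀ y w w' : V lam, ZFSet.pair y.1 w.1 ∈ (v 0).1 →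
    ZFSet.pair y.1 w'.1 ∈ (v 0).1 → w = w'
  have hS : Dfn S := Dfn.all (Dfn.all (Dfn.all ((Dfn.pair_mem _ _ _).imp
    ((Dfn.pair_mem _ _ _).imp (Dfn.eq _ _)))))
  have hRk : ∀ z : V lam, z.1 ∈ (k (lev (c 0))).1 → ∃ y : V lam, y.1 ∈ (k x).1 ∧
      ∃ w : V lam, ZFSet.pair y.1 w.1 ∈ (k f).1 ∧ z.1 ⊆ w.1 := by
    refine (hR.map_iff k ![lev (c 0), x, f]).2 fun z hz => ?_
    obtain ⟨y, hy, hlt⟩ := hcon _ (ZFSet.mem_vonNeumann.1 hz)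
    exact ⟨y, hy, lev ⟨F y, (hF y hy).trans (c 0).2⟩, hf.2 ⟨hy, rfl⟩, ZFSet.subset_vonNeumann.2 hlt⟩
  have hSk : ∀ y w w' : V lam, ZFSet.pair y.1 w.1 ∈ (k f).1 →
      ZFSet.pair y.1 w'.1 ∈ (k f).1 → w = w' :=
    (hS.map_iff k ![f]).2 fun y w w' hw hw' =>
      Subtype.ext ((hf.1 hw).2.trans (hf.1 hw').2.symm)
  obtain ⟨y, hy, w, hw, hlt⟩ := hRk (lev (c 0)) (by
    rw [hc.map_lev]
    exact ZFSet.vonNeumann_mem_of_lt (hc.strictMono Nat.one_pos))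
  rw [hc.fix x hx] at hy
  let l : V lam := lev ⟨F y, (hF y hy).trans (c 0).2⟩
  have hl : ZFSet.pair (k y).1 (k l).1 ∈ (k f).1 := (map_pair_mem_iff k y l f).2 (hf.2 ⟨hy, rfl⟩)
  rw [hc.fix y (htr hy), hc.fix l (ZFSet.vonNeumann_mem_of_lt (hF y hy))] at hl
  rw [hSk y w l hw hl] at hlt
  exact (ZFSet.vonNeumann_subset_vonNeumann_iff.1 hlt).not_gt (hF y hy)

/-- The critical point is not `ω`, since every nonempty member of `ω` has a greatest member. -/
theorem IsShift.ne_omega0 {k : V lam ↪ₑ[setLang] V lam} {c : ℕ → Set.Iio lam}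
    (hc : IsShift k c) : (c 0).1 ≠ Ordinal.omega0 := by
  intro h0
  let R : (Fin 1 → V lam) → Prop := fun v => ∀ y : V lam, y.1 ∈ (v 0).1 →
    (∃ z : V lam, z.1 ∈ y.1) → ∃ z : V lam, z.1 ∈ y.1 ∧ ∀ w : V lam, w.1 ∈ y.1 → w.1 ⊆ z.1
  have hR : Dfn R := Dfn.all ((Dfn.mem _ _).imp ((Dfn.ex (Dfn.mem _ _)).imp
    (Dfn.ex ((Dfn.mem _ _).and (Dfn.all ((Dfn.mem _ _).imp (Dfn.subset _ _)))))))
  have hRk : R ![k (ord (c 0))] := by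
    refine (hR.of_iff (S := fun v => R ![v 0]) fun _ => Iff.rfl).map_iff k ![ord (c 0)] |>.2 ?_
    rintro y hy ⟨z, hz⟩
    obtain ⟨α, hα, hy⟩ := Ordinal.mem_toZFSet_iff.1 hy
    rw [h0] at hα
    obtain ⟨n, rfl⟩ := Ordinal.lt_omega0.1 hα
    rw [← hy] at hz
    cases n with
    | zero => simp at hz
    | succ n =>
      have hn : (n : Ordinal.{u}).toZFSet ∈ y.1 := by
        rw [← hy, Ordinal.toZFSet_mem_toZFSet_iff]
        exact_mod_cast n.lt_succ_self
      refine ⟨⟨_, mem_V_of_mem hn⟩, hn, fun w hw => ?_⟩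
      rw [← hy] at hw
      obtain ⟨β, hβ, hw⟩ := Ordinal.mem_toZFSet_iff.1 hw
      rw [← hw, Ordinal.toZFSet_subset_toZFSet_iff]
      push_cast at hβ
      exact Order.lt_add_one_iff.1 hβ
  rw [(map_lev_iff k).1 (hc.map_lev 0)] at hRk
  have h00 : (0 : Ordinal.{u}) < (c 0).1 := h0 ▸ Ordinal.omega0_pos
  obtain ⟨z, hz, hmax⟩ := hRk (ord (c 0)) (ord_mem_ord_iff.2 (hc.strictMono Nat.one_pos))
    ⟨ord ⟨0, h00.trans (c 0).2⟩, ord_mem_ord_iff.2 h00⟩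
  obtain ⟨α, hα, hz⟩ := Ordinal.mem_toZFSet_iff.1 hz
  have hsucc : α + 1 < (c 0).1 := by
    rw [h0] at hα ⊢
    exact Ordinal.isSuccLimit_omega0.add_one_lt hα
  have := hmax (ord ⟨α + 1, hsucc.trans (c 0).2⟩) (ord_mem_ord_iff.2 hsucc)
  rw [← hz, ord, Ordinal.toZFSet_subset_toZFSet_iff] at this
  exact this.not_gt (lt_add_one α)

/-- An increasing `ω`-sequence below the critical point is bounded below it. -/
theorem IsShift.exists_bound_nat {k : V lam ↪ₑ[setLang] V lam} {c : ℕ → Set.Iio lam}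
    (hc : IsShift k c) {F : ℕ → Ordinal.{u}} (hmono : StrictMono F) (hF : ∀ n, F n < (c 0).1) :
    ∃ β < (c 0).1, ∀ n, F n < β := by
  have hle : ∀ n : ℕ, (n : Ordinal.{u}) ≤ F n := by
    intro n
    induction n with
    | zero => simp
    | succ n ih =>
      push_cast
      exact Order.add_one_le_of_lt (ih.trans_lt (hmono n.lt_succ_self))
  have hω : Ordinal.omega0 < (c 0).1 := by
    refine lt_of_le_of_ne (Ordinal.omega0_le.2 fun n => ?_) hc.ne_omega0.symm
    exact (hle n).trans (hF n).le
  obtain ⟨β, hβ, h⟩ := hc.exists_bound (x := ord ⟨_, hω.trans (c 0).2⟩)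
    (by rwa [ZFSet.mem_vonNeumann, ord, Ordinal.rank_toZFSet])
    (fun y => F (Cardinal.toNat y.1.rank.card)) (fun y _ => hF _)
  refine ⟨β, hβ, fun n => ?_⟩
  have hn : (n : Ordinal.{u}) < Ordinal.omega0 := Ordinal.natCast_lt_omega0 n
  simpa [ord] using h (ord ⟨n, (hn.trans hω).trans (c 0).2⟩) (ord_mem_ord_iff.2 hn)

end Regular

/-! ### Approximations to an embedding -/

section Approx

variable {lam : Ordinal.{u}}

/-- The partial map with graph `s` preserves the truth of `φ` in `V_lam`. -/
def PreservesTruth {n : ℕ} (φ : setLang.Formula (Fin n)) (s : V lam) : Prop :=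
  ∀ x y : Fin n → V lam, (∀ i, ZFSet.pair (x i).1 (y i).1 ∈ s.1) → (φ.Realize x ↔ φ.Realize y)

/-- The set `a` satisfies the Tarski–Vaught criterion in `V_lam` for `φ`, with any one of its
variables as the one to be witnessed. -/
def HasWitnesses {n : ℕ} (φ : setLang.Formula (Fin n)) (a : V lam) : Prop :=
  ∀ (x : Fin n → V lam) (i : Fin n), (∀ l, l ≠ i → (x l).1 ∈ a.1) → φ.Realize x →
    ∃ y : V lam, y.1 ∈ a.1 ∧ φ.Realize (Function.update x i y)

/-- `a` is the domain of the relation `s`. -/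
def IsDomain (s a : V lam) : Prop :=
  ∀ x : V lam, x.1 ∈ a.1 ↔ ∃ y : V lam, ZFSet.pair x.1 y.1 ∈ s.1

/-- With `Φ` an enumeration of the formulas, `Approx Φ m s s'` says that `s` is a partial map from
a level `a` of the hierarchy to a later level `a'`, that preserves truth for the first `m + 1`
formulas, and that it is followed by `s'`, which extends `s`, has domain `a'` and sends `a` to `a'`.
The level `a` passes the Tarski–Vaught test for the same formulas, and at `m = 0` the map `s` is
the identity. Only finitely many formulas are mentioned, so for each `m` this relation is
definable over `V_lam`; truth is always taken in `V_lam`. -/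
def Approx (Φ : ℕ → Σ n, setLang.Formula (Fin n)) (m : ℕ) (s s' : V lam) : Prop :=
  ∃ a a' : V lam, (∃ α, a.1 = V_ α) ∧ (∃ α, a'.1 = V_ α) ∧ IsDomain s a ∧ IsDomain s' a' ∧
    s.1 ⊆ s'.1 ∧ (∀ x y : V lam, ZFSet.pair x.1 y.1 ∈ s.1 → y.1 ∈ a'.1) ∧
    ZFSet.pair a.1 a'.1 ∈ s'.1 ∧ (∀ i : Fin (m + 1), PreservesTruth (Φ i).2 s) ∧
    (∀ i : Fin (m + 1), HasWitnesses (Φ i).2 a) ∧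
    (m = 0 → ∀ x : V lam, x.1 ∈ a.1 → ZFSet.pair x.1 x.1 ∈ s.1)

section

variable {ι : Type}

theorem Dfn.preservesTruth {n : ℕ} (φ : setLang.Formula (Fin n)) (s : ι) :
    Dfn (fun v : ι → V lam => PreservesTruth φ (v s)) :=
  Dfn.forall_tuple (Dfn.forall_tuple ((Dfn.forall_finite fun _ => Dfn.pair_mem _ _ _).imp
    ((Dfn.realize φ fun i => Sum.inl (Sum.inr i)).iff (Dfn.realize φ Sum.inr))))

theorem Dfn.hasWitnesses {n : ℕ} (φ : setLang.Formula (Fin n)) (a : ι) :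
    Dfn (fun v : ι → V lam => HasWitnesses φ (v a)) :=
  Dfn.forall_tuple (Dfn.forall_finite fun _ => Dfn.imp
    (Dfn.forall_finite fun _ => (Dfn.const _).imp (Dfn.mem _ _))
    ((Dfn.realize φ _).imp (Dfn.ex ((Dfn.mem _ _).and
      (Dfn.realize_update φ (fun l => Sum.inl (Sum.inr l)) _ _)))))

theorem Dfn.isDomain (s a : ι) : Dfn (fun v : ι → V lam => IsDomain (v s) (v a)) :=
  Dfn.all ((Dfn.mem _ _).iff (Dfn.ex (Dfn.pair_mem _ _ _)))

theorem Dfn.approx (Φ : ℕ → Σ n, setLang.Formula (Fin n)) (m : ℕ) (s s' : ι) :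
    Dfn (fun v : ι → V lam => Approx Φ m (v s) (v s')) :=
  Dfn.ex (Dfn.ex ((Dfn.eq_vonNeumann _).and ((Dfn.eq_vonNeumann _).and ((Dfn.isDomain _ _).and
    ((Dfn.isDomain _ _).and ((Dfn.subset _ _).and
    ((Dfn.all (Dfn.all ((Dfn.pair_mem _ _ _).imp (Dfn.mem _ _)))).and ((Dfn.pair_mem _ _ _).and
    ((Dfn.forall_finite fun _ => Dfn.preservesTruth _ _).and
    ((Dfn.forall_finite fun _ => Dfn.hasWitnesses _ _).and
    ((Dfn.const _).imp (Dfn.all ((Dfn.mem _ _).imp (Dfn.pair_mem _ _ _))))))))))))))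

end

theorem countable_formulas : Countable (Σ n, setLang.Formula (Fin n)) := by
  have h1 : ∀ l, Countable (setLang.Functions l) := fun l => inferInstanceAs (Countable Empty)
  have h2 : ∀ l, Countable (setLang.Relations l) := fun l =>
    Function.Injective.countable (f := fun _ : MemSymbol l => ()) fun a b _ => by
      cases a; cases b; rfl
  have : Countable setLang.Symbols := inferInstanceAs (Countable (_ ⊕ _))
  infer_instance

/-- `V_γ` as a substructure of `V_lam`. -/
def inclusion {gam : Ordinal.{u}} (hle : gam ≤ lam) : V gam ↪[setLang] V lam where
  toFun x := ⟨x.1, ZFSet.vonNeumann_subset_of_le hle x.2⟩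
  inj' _ _ h := Subtype.ext (congrArg (fun z : V lam => z.1) h)
  map_fun' f := f.elim
  map_rel' := by
    rintro n ⟨⟩ x
    exact Iff.rfl

/-- The union of an infinite branch of approximations is an I3 embedding of `V_γ`, where `γ` is the
supremum of the domains: the Tarski–Vaught tests make `V_γ` an elementary submodel of `V_lam`, so
preserving truth in `V_lam` is the same as preserving truth in `V_γ`. -/
theorem exists_I3_of_branch {Φ : ℕ → Σ n, setLang.Formula (Fin n)} (hΦ : Function.Surjective Φ)
    {s : ℕ → V lam} (hs : ∀ m, Approx Φ m (s m) (s (m + 1))) :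
    ∃ α : ℕ → Ordinal.{u}, StrictMono α ∧ (∀ m, α m < (s (m + 1)).1.rank) ∧
      ∀ gam, IsLUB (Set.range α) gam → I3 gam := by
  choose a a' hα hα' hdom hdom' hsub hran hpair htruth hwit hid using hs
  obtain rfl : a' = fun m => a (m + 1) := funext fun m => V_ext fun x =>
    (hdom' m x).trans (hdom (m + 1) x).symm
  choose α hα using hα
  have hmem : ∀ {m} {x : V lam}, x.1 ∈ (a m).1 ↔ x.1.rank < α m := fun {m x} => by
    rw [hα, ZFSet.mem_vonNeumann]
  have hrank : ∀ m, (a m).1.rank = α m := fun m => by rw [hα, ZFSet.rank_vonNeumann]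
  have hsm : ∀ {m n}, m ≤ n → (s m).1 ⊆ (s n).1 := fun {m n} hmn => by
    induction n, hmn using Nat.le_induction with
    | base => exact subset_rfl
    | succ n _ ih => exact ih.trans (hsub n)
  have hmono : StrictMono α := strictMono_nat_of_lt_succ fun m => by
    rw [← hrank m, ← hmem]
    exact (hdom (m + 1) _).2 ⟨_, hpair m⟩
  refine ⟨α, hmono, fun m => ?_, fun gam hgam => ?_⟩
  · rw [← hrank]
    exact (ZFSet.rank_lt_of_mem (ZFSet.mem_singleton.2 rfl)).trans
      ((ZFSet.rank_lt_of_mem (ZFSet.mem_pair.2 (Or.inl rfl))).trans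
        (ZFSet.rank_lt_of_mem (hpair m)))
  have hlt : ∀ m, α m < gam := fun m =>
    (hmono m.lt_succ_self).trans_le (hgam.1 ⟨m + 1, rfl⟩)
  have hle : gam ≤ lam := hgam.2 (by
    rintro _ ⟨m, rfl⟩
    rw [← hrank]
    exact (ZFSet.mem_vonNeumann.1 (a m).2).le)
  have hex : ∀ x ∈ V_ gam, ∃ m, x.rank < α m := fun x hx => by
    obtain ⟨_, ⟨m, rfl⟩, hm⟩ := (lt_isLUB_iff hgam).1 (ZFSet.mem_vonNeumann.1 hx)
    exact ⟨m, hm⟩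
  let inc := inclusion hle
  have hkex : ∀ x : V gam, ∃ y : V gam, ∃ m, ZFSet.pair (inc x).1 (inc y).1 ∈ (s m).1 := by
    intro x
    obtain ⟨m, hm⟩ := hex x.1 x.2
    obtain ⟨y, hy⟩ := (hdom m (inc x)).1 (hmem.2 hm)
    exact ⟨⟨y.1, ZFSet.mem_vonNeumann.2 ((hmem.1 (hran m _ _ hy)).trans (hlt _))⟩, m, hy⟩
  choose k hk using hkex
  have htask : ∀ {n} (φ : setLang.Formula (Fin n)),
      ∃ t, ∀ m, t ≤ m → PreservesTruth φ (s m) ∧ HasWitnesses φ (a m) := by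
    intro n φ
    obtain ⟨t, ht⟩ := hΦ ⟨n, φ⟩
    refine ⟨t, fun m hm => ?_⟩
    have h : (fun p : Σ n, setLang.Formula (Fin n) =>
        PreservesTruth p.2 (s m) ∧ HasWitnesses p.2 (a m)) (Φ t) :=
      ⟨htruth m ⟨t, by omega⟩, hwit m ⟨t, by omega⟩⟩
    rwa [ht] at h
  have hpres : ∀ {n} (φ : setLang.Formula (Fin n)) (x y : Fin n → V lam),
      (∀ i, ∃ m, ZFSet.pair (x i).1 (y i).1 ∈ (s m).1) → (φ.Realize x ↔ φ.Realize y) := by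
    intro n φ x y hxy
    choose f hf using hxy
    obtain ⟨M, hM⟩ := Set.finite_range f |>.bddAbove
    obtain ⟨t, ht⟩ := htask φ
    exact (ht (max t M) (le_max_left _ _)).1 x y fun i =>
      hsm (le_max_of_le_right (hM ⟨i, rfl⟩)) (hf i)
  have hfun : ∀ x y y' : V lam, (∃ m, ZFSet.pair x.1 y.1 ∈ (s m).1) →
      (∃ m, ZFSet.pair x.1 y'.1 ∈ (s m).1) → y = y' := by
    intro x y y' h h'
    have := hpres ((Term.var (0 : Fin 2)).equal (Term.var 1)) ![x, x] ![y, y'] (by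
      intro i
      fin_cases i
      exacts [h, h'])
    simpa [Formula.realize_equal] using this
  have hinc : ∀ {n} (φ : setLang.Formula (Fin n)) (x : Fin n → V gam),
      φ.Realize (inc ∘ x) ↔ φ.Realize x := by
    refine inc.isElementary_of_exists fun n ψ x b hb => ?_
    let φ : setLang.Formula (Fin (n + 1)) := ψ.toFormula.relabel (Sum.elim Empty.elim id)
    have hφ : ∀ v : Fin (n + 1) → V lam, φ.Realize v ↔ ψ.Realize default v := fun v => by
      rw [Formula.realize_relabel, BoundedFormula.realize_toFormula]
      exact iff_of_eq (congrArg₂ _ (Subsingleton.elim _ _) rfl)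
    choose f hf using fun i => hex (x i).1 (x i).2
    obtain ⟨M, hM⟩ := Set.finite_range f |>.bddAbove
    obtain ⟨t, ht⟩ := htask φ
    have hlow : ∀ l, l ≠ Fin.last n →
        ((Fin.snoc (inc ∘ x) b : Fin (n + 1) → V lam) l).1 ∈ (a (max t M)).1 := by
      intro l hl
      obtain ⟨l, rfl⟩ := Fin.exists_castSucc_eq.2 hl
      rw [Fin.snoc_castSucc, hmem]
      exact (hf l).trans_le (hmono.monotone (le_max_of_le_right (hM ⟨l, rfl⟩)))
    obtain ⟨y, hy, hyφ⟩ := (ht (max t M) (le_max_left _ _)).2 _ _ hlow ((hφ _).2 hb)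
    rw [Fin.update_snoc_last, hφ] at hyφ
    exact ⟨⟨y.1, ZFSet.mem_vonNeumann.2 ((hmem.1 hy).trans (hlt _))⟩, hyφ⟩
  let K : V gam ↪ₑ[setLang] V gam := ⟨k, fun n φ x => by
    rw [← hinc, ← hinc]
    exact (hpres φ _ _ fun i => hk (x i)).symm⟩
  let κ : ℕ → Set.Iio gam := fun m => ⟨α m, hlt m⟩
  have hlev : ∀ m, inc (lev (κ m)) = a m := fun m => Subtype.ext (hα m).symm
  have hsucc : ∀ m, ord (κ (m + 1)) = K (ord (κ m)) := by
    refine fun m => ((map_lev_iff K).1 (inc.injective (hfun (a m) _ _ ?_ ?_))).symm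
    · rw [← hlev m]
      exact hk _
    · rw [hlev]
      exact ⟨m + 1, hpair m⟩
  have hcrit : (ord (κ 0)).1 ∈ (K (ord (κ 0))).1 := by
    rw [← hsucc]
    exact ord_mem_ord_iff.2 (hmono Nat.one_pos)
  refine ⟨K, κ, fun hK => ?_, ⟨⟨hcrit, fun β hβ => ?_⟩, hsucc⟩, hgam⟩
  · rw [hK] at hcrit
    exact ZFSet.mem_irrefl _ hcrit
  · by_contra hlt0
    have hβ0 : (inc (ord β)).1 ∈ (a 0).1 := by
      rw [hmem]
      exact (Ordinal.rank_toZFSet β.1).trans_lt (not_le.1 hlt0)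
    have : K (ord β) = ord β :=
      inc.injective (hfun _ _ _ (hk (ord β)) ⟨0, hid 0 rfl _ hβ0⟩)
    change (ord β).1 ∈ (K (ord β)).1 at hβ
    rw [this] at hβ
    exact ZFSet.mem_irrefl _ hβ

end Approx

/-! ### A branch below the critical point -/

section Branch

variable {lam : Ordinal.{u}} {J : ℕ → V lam → V lam} {κ : ℕ → Set.Iio lam}

/-- The restrictions of `J 0` to the levels `V_(κ m)` are a branch of approximations. -/
theorem IsShiftSystem.exists_branch (h : IsShiftSystem J κ)
    (Φ : ℕ → Σ n, setLang.Formula (Fin n)) :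
    ∃ t : ℕ → V lam, (∀ m, (t m).1 ∈ V_ (κ (m + 4)).1) ∧ ∀ m, Approx Φ m (t m) (t (m + 1)) := by
  obtain ⟨e, he⟩ := h.elementary 0
  have hc : IsShift e κ := by simpa only [Nat.zero_add, he] using h.isShift 0
  have hran : ∀ {m} {x : V lam}, x.1 ∈ (lev (κ m)).1 → (e x).1 ∈ (lev (κ (m + 1))).1 :=
    fun {m x} hx => by rwa [← hc.map_lev, map_mem_iff]
  let t : ℕ → V lam := fun m => graphOn (lev (κ (m + 3))) (lev (κ m)) fun x => (e x).1
  have ht : ∀ {m} {x y : V lam}, ZFSet.pair x.1 y.1 ∈ (t m).1 ↔ x.1 ∈ (lev (κ m)).1 ∧ y = e x :=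
    fun {m x y} => (pair_mem_graphOn fun x hx =>
      hc.pair_mem (h.mem_of_le m.le_succ hx) (hran hx)).trans
        (and_congr_right fun _ => Subtype.ext_iff.symm)
  have hdom : ∀ m, IsDomain (t m) (lev (κ m)) := fun m x =>
    ⟨fun hx => ⟨e x, ht.2 ⟨hx, rfl⟩⟩, fun ⟨_, hy⟩ => (ht.1 hy).1⟩
  refine ⟨t, fun m => ?_, fun m => ⟨lev (κ m), lev (κ (m + 1)), ⟨_, rfl⟩, ⟨_, rfl⟩, hdom m,
    hdom (m + 1), ?_, ?_, ?_, ?_, fun i x l hx hφ => h.exists_witness _ hx hφ, ?_⟩⟩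
  · exact ZFSet.mem_vonNeumann_of_subset (fun z hz => (mem_graphOn.1 hz).1)
      (ZFSet.vonNeumann_mem_of_lt (h.strictMono (m + 3).lt_succ_self))
  · intro z hz
    obtain ⟨-, x, hx, rfl⟩ := mem_graphOn.1 hz
    exact ht.2 ⟨h.mem_of_le m.le_succ hx, rfl⟩
  · intro x y hxy
    obtain ⟨hx, rfl⟩ := ht.1 hxy
    exact hran hx
  · exact ht.2 ⟨ZFSet.vonNeumann_mem_of_lt (h.strictMono m.lt_succ_self), (hc.map_lev m).symm⟩
  · intro i x y hxy
    obtain rfl : y = e ∘ x := funext fun l => (ht.1 (hxy l)).2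
    exact (e.map_formula _ x).symm
  · rintro rfl x hx
    exact ht.2 ⟨hx, (hc.fix x hx).symm⟩

/-- `q` is a one-step continuation, below rank `κ`, of the approximation `p`; approximations are
paired with their index. -/
def Continues (Φ : ℕ → Σ n, setLang.Formula (Fin n)) (κ : Ordinal.{u}) (q p : ℕ × V lam) : Prop :=
  q.1 = p.1 + 1 ∧ q.2.1 ∈ V_ κ ∧ Approx Φ p.1 p.2 q.2

/-- On the well-founded part of `Continues Φ (κ 0)` there is a rank function with values below
`κ 1`, because `κ 1` is regular with respect to functions on `V_(κ 0)`. -/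
theorem IsShiftSystem.exists_rank (h : IsShiftSystem J κ)
    (Φ : ℕ → Σ n, setLang.Formula (Fin n)) :
    ∃ ρ : ℕ × V lam → Ordinal.{u}, (∀ p, ρ p < (κ 1).1) ∧
      ∀ q p, Continues Φ (κ 0).1 q p → Acc (Continues Φ (κ 0).1) p → ρ q < ρ p := by
  -- Discarding the pairs outside the well-founded part makes the relation well-founded.
  let r : ℕ × V lam → ℕ × V lam → Prop := fun q p =>
    Continues Φ (κ 0).1 q p ∧ Acc (Continues Φ (κ 0).1) p
  have wf : WellFounded r := ⟨fun p => by
    refine ⟨_, fun q hq => ?_⟩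
    have hacc := hq.2.inv hq.1
    clear hq
    induction hacc with
    | intro q _ ih => exact ⟨_, fun q' hq' => ih q' hq'.1⟩⟩
  have hsmallV : Small.{u} (V lam) := ZFSet.small_coe (V_ lam)
  let ρ : ℕ × V lam → Ordinal.{u} := wf.fix fun p ih => ⨆ q : {q // r q p}, ih q.1 q.2 + 1
  have hρ : ∀ p, ρ p = ⨆ q : {q // r q p}, (ρ q.1 + 1) := fun p => wf.fix_eq _ p
  refine ⟨ρ, fun p => ?_, fun q p hqp hp => ?_⟩
  · induction p using wf.induction with
    | _ p ih =>
      obtain ⟨e, he⟩ := h.elementary 1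
      have hc : IsShift e (fun i => κ (1 + i)) := he ▸ h.isShift 1
      classical
      obtain ⟨β, hβ, hlt⟩ := hc.exists_bound (x := lev (κ 0))
        (ZFSet.vonNeumann_mem_of_lt (h.strictMono Nat.one_pos))
        (fun y => if r (p.1 + 1, y) p then ρ (p.1 + 1, y) else 0) (fun y _ => by
          split_ifs with hy
          · exact ih _ hy
          · exact zero_le.trans_lt (h.strictMono Nat.one_pos : κ 0 < κ 1))
      rw [hρ]
      refine lt_of_le_of_lt (Ordinal.iSup_le fun ⟨q, hq⟩ => ?_) hβ
      obtain ⟨n, y⟩ := q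
      obtain rfl : n = p.1 + 1 := hq.1.1
      have := hlt y hq.1.2.1
      rw [if_pos hq] at this
      exact Order.add_one_le_of_lt this
  · rw [hρ p]
    exact (lt_add_one _).trans_le
      (Ordinal.le_iSup (fun q : {q // r q p} => ρ q.1 + 1) ⟨q, hqp, hp⟩)

/-- If the limit is well-founded, then there is a branch of approximations in `V_(κ 0)`. Otherwise
the rank function of the tree of these approximations is sent by `j_{0,n}` to a rank function for
the approximations in `V_(κ n)`, and its values along the branch of restrictions of `J 0` represent
an infinite descending sequence in the limit. -/
theorem IsShiftSystem.exists_low_branch (h : IsShiftSystem J κ) (wf : WellFounded (limitMem J))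
    (Φ : ℕ → Σ n, setLang.Formula (Fin n)) :
    ∃ s : ℕ → V lam, (∀ m, (s m).1 ∈ V_ (κ 0).1) ∧ ∀ m, Approx Φ m (s m) (s (m + 1)) := by
  by_contra hno
  have hacc : ∀ s : V lam, s.1 ∈ V_ (κ 0).1 → Acc (Continues Φ (κ 0).1) (0, s) := by
    intro s hs
    by_contra hna
    obtain ⟨f, hf0, hf⟩ := not_acc_iff_exists_descending_chain.1 hna
    have hfst : ∀ n, (f n).1 = n := fun n => by
      induction n with
      | zero => rw [hf0]
      | succ n ih => rw [(hf n).1, ih]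
    refine hno ⟨fun n => (f n).2, fun m => ?_, fun m => ?_⟩
    · cases m with
      | zero =>
        change (f 0).2.1 ∈ _
        rwa [hf0]
      | succ m => exact (hf m).2.1
    · have := (hf m).2.2
      rwa [hfst] at this
  obtain ⟨ρ, hρ, hdec⟩ := h.exists_rank Φ
  obtain ⟨t, htV, ht⟩ := h.exists_branch Φ
  have hc : IsShift (J 0) κ := by simpa only [Nat.zero_add] using h.isShift 0
  -- The rank function on the accessible approximations of index `m`, as a set.
  let x : ℕ → V lam := fun m =>
    ⟨ZFSet.sep (fun z => ∃ y : V lam, y.1 = z ∧ Acc (Continues Φ (κ 0).1) (m, y)) (V_ (κ 0).1),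
      ZFSet.mem_vonNeumann_of_subset ZFSet.sep_subset (lev (κ 0)).2⟩
  have hx : ∀ {m} {y : V lam}, y.1 ∈ (x m).1 ↔
      y.1 ∈ V_ (κ 0).1 ∧ Acc (Continues Φ (κ 0).1) (m, y) := fun {m y} => by
    dsimp only [x]
    rw [ZFSet.mem_sep]
    refine and_congr_right fun _ => ⟨?_, fun hy => ⟨y, rfl, hy⟩⟩
    rintro ⟨z, hz, hacc⟩
    rwa [← Subtype.ext hz]
  let f : ℕ → V lam := fun m => graphOn (lev (κ 3)) (x m) fun y => V_ (ρ (m, y))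
  have hf : ∀ {m} {y : V lam} {w : ZFSet.{u}}, ZFSet.pair y.1 w ∈ (f m).1 ↔
      y.1 ∈ (x m).1 ∧ w = V_ (ρ (m, y)) := fun {m} => pair_mem_graphOn fun y hy =>
    hc.pair_mem (h.mem_of_le zero_le_one (hx.1 hy).1)
      (ZFSet.vonNeumann_mem_of_lt (hρ (m, y)))
  let w : ℕ × V lam → V lam := fun p => lev ⟨ρ p, (hρ p).trans (κ 1).2⟩
  have hstart : ∀ n, ∀ s : V lam, s.1 ∈ V_ (κ n).1 →
      ∃ y : V lam, ZFSet.pair s.1 y.1 ∈ (step J 0 n (f 0)).1 := by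
    intro n
    obtain ⟨e, he⟩ := h.exists_step 0 n
    have hlev := h.step_lev 0 n
    rw [Nat.zero_add] at hlev
    let R : (Fin 2 → V lam) → Prop := fun v => ∀ s : V lam, s.1 ∈ (v 0).1 →
      ∃ y : V lam, ZFSet.pair s.1 y.1 ∈ (v 1).1
    have hR : Dfn R := Dfn.all ((Dfn.mem _ _).imp (Dfn.ex (Dfn.pair_mem _ _ _)))
    have := (hR.map_iff e ![lev (κ 0), f 0]).2 fun s hs =>
      ⟨w (0, s), hf.2 ⟨hx.2 ⟨hs, hacc s hs⟩, rfl⟩⟩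
    intro s hs
    refine (this s ?_).imp fun y hy => he ▸ hy
    change s.1 ∈ (e (lev (κ 0))).1
    rwa [he, hlev]
  have hstep : ∀ n m, ∀ s s' y : V lam, s'.1 ∈ V_ (κ n).1 → Approx Φ m s s' →
      ZFSet.pair s.1 y.1 ∈ (step J 0 n (f m)).1 →
      ∃ y' : V lam, ZFSet.pair s'.1 y'.1 ∈ (step J 0 n (f (m + 1))).1 ∧ y'.1 ∈ y.1 := by
    intro n m
    obtain ⟨e, he⟩ := h.exists_step 0 n
    have hlev := h.step_lev 0 n
    rw [Nat.zero_add] at hlev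
    let R : (Fin 3 → V lam) → Prop := fun v => ∀ s s' y : V lam, s'.1 ∈ (v 0).1 →
      Approx Φ m s s' → ZFSet.pair s.1 y.1 ∈ (v 1).1 →
      ∃ y' : V lam, ZFSet.pair s'.1 y'.1 ∈ (v 2).1 ∧ y'.1 ∈ y.1
    have hR : Dfn R := Dfn.all (Dfn.all (Dfn.all ((Dfn.mem _ _).imp ((Dfn.approx _ _ _ _).imp
      ((Dfn.pair_mem _ _ _).imp (Dfn.ex ((Dfn.pair_mem _ _ _).and (Dfn.mem _ _))))))))
    have := (hR.map_iff e ![lev (κ 0), f m, f (m + 1)]).2 fun s s' y hs' hss' hsy => by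
      obtain ⟨hs, hy⟩ := hf.1 hsy
      have hcont : Continues Φ (κ 0).1 (m + 1, s') (m, s) := ⟨rfl, hs', hss'⟩
      have hs := (hx.1 hs).2
      refine ⟨w (m + 1, s'), hf.2 ⟨hx.2 ⟨hs', hs.inv hcont⟩, rfl⟩, ?_⟩
      rw [hy]
      exact ZFSet.vonNeumann_mem_of_lt (hdec _ _ hcont hs)
    intro s s' y hs' hss' hsy
    rw [← he]
    refine this s s' y ?_ hss' ?_
    · change s'.1 ∈ (e (lev (κ 0))).1
      rwa [he, hlev]
    · change _ ∈ (e (f m)).1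
      rwa [he]
  have hdesc : ∀ z : Limit J, ∀ m y, z = toLimit J (m + 4) y →
      ZFSet.pair (t m).1 y.1 ∉ (step J 0 (m + 4) (f m)).1 := by
    intro z
    induction z using wf.induction with
    | _ z ih =>
      rintro m y rfl hy
      obtain ⟨e, he⟩ := h.elementary (m + 4)
      have hfix : e (t m) = t m := he ▸ (h.isShift (m + 4)).fix (t m) (htV m)
      have hstepf : step J 0 (m + 5) (f m) = e (step J 0 (m + 4) (f m)) := by
        rw [he, step, Nat.zero_add]
        rfl
      have hy' := (map_pair_mem_iff e _ _ _).2 hy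
      rw [hfix, ← hstepf] at hy'
      obtain ⟨y', hy1, hy2⟩ := hstep (m + 5) m _ _ _ (htV (m + 1)) (ht m) hy'
      refine ih _ ⟨m + 5, y', e y, rfl, ?_, hy2⟩ (m + 1) y' rfl hy1
      rw [← toLimit_step (m + 4) 1 y, he]
      rfl
  obtain ⟨y, hy⟩ := hstart 4 (t 0) (htV 0)
  exact hdesc _ 0 y rfl hy

theorem IsShiftSystem.exists_I3 (h : IsShiftSystem J κ) (wf : WellFounded (limitMem J)) :
    ∃ gam < (κ 0).1, I3 gam := by
  have := countable_formulas
  have : Nonempty (Σ n, setLang.Formula (Fin n)) := ⟨⟨0, ⊥⟩⟩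
  obtain ⟨Φ, hΦ⟩ := exists_surjective_nat (Σ n, setLang.Formula (Fin n))
  obtain ⟨s, hsV, hs⟩ := h.exists_low_branch wf Φ
  obtain ⟨α, hmono, hrank, hI3⟩ := exists_I3_of_branch hΦ hs
  obtain ⟨e, he⟩ := h.elementary 0
  have hc : IsShift e κ := by simpa only [Nat.zero_add, he] using h.isShift 0
  obtain ⟨β, hβ, hle⟩ := hc.exists_bound_nat hmono fun m =>
    (hrank m).trans (ZFSet.mem_vonNeumann.1 (hsV (m + 1)))
  refine ⟨⨆ m, α m, (Ordinal.iSup_le fun m => (hle m).le).trans_lt hβ, hI3 _ ?_⟩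
  exact isLUB_ciSup Ordinal.bddAbove_of_small

end Branch

end RankIntoRank

theorem mainTheorem5 :
    RankIntoRank.StronglyImplies RankIntoRank.OmegaIterableI3.{u} RankIntoRank.I3.{u} ∧
    ∀ (lam : Ordinal.{u})
      (j : RankIntoRank.V lam ↪ₑ[RankIntoRank.setLang] RankIntoRank.V lam)
      (κ : ℕ → Set.Iio lam) (J : ℕ → RankIntoRank.V lam → RankIntoRank.V lam)
      (wf : WellFounded (RankIntoRank.limitMem J)),
      RankIntoRank.IsI3Embedding j κ → RankIntoRank.IsIterateSequence j J →
        (∀ x ∈ V_ lam, x ∈ RankIntoRank.MOmega wf) ∧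
        RankIntoRank.iterOmega wf 0 (RankIntoRank.ord (κ 0)) = lam.toZFSet ∧
        ∃ gamma < (κ 0 : Ordinal.{u}), RankIntoRank.I3 gamma := by
  refine ⟨⟨fun lam ⟨j, κ, hj, _⟩ => ⟨j, κ, hj⟩, fun lam hlam => ?_⟩,
    fun lam j κ J wf hj hJ => ?_⟩
  · obtain ⟨j, κ, hj, J, hJ, wf⟩ := hlam.1
    obtain ⟨gam, hgam, hI3⟩ := (hJ.isShiftSystem hj).exists_I3 wf
    have hne : {x | RankIntoRank.I3.{u} x}.Nonempty := ⟨gam, hI3⟩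
    have hleast := isLeast_csInf hne
    exact ⟨_, hleast, ((hleast.2 hI3).trans_lt hgam).trans (κ 0).2⟩
  · have h := hJ.isShiftSystem hj
    exact ⟨fun x hx => h.mem_MOmega wf hx, h.iterOmega_ord wf, h.exists_I3 wf⟩
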